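/- Logarithms are to base $2$ and graphs are finite and simple. For graphs $G,H$ let $G\boxtimes H$ be the strong product (distinct pairs are adjacent iff in each coordinate they are equal or adjacent), $G^{\boxtimes n}$ the $n$-fold strong power, with vertex set $V(G)^n$, and $G[S]$ the subgraph induced by $S\subseteq V(G)$. A spectral point is a function $f$ from graphs to $\mathbb{R}_{\ge 0}$ with $f(G\sqcup H)=f(G)+f(H)$, $f(G\boxtimes H)=f(G)f(H)$, $f(\overline{K_d})=d$, and $f(H)\le f(G)$ whenever there is a graph homomorphism $\overline{H}\to\overline{G}$. For a probability distribution $P$ on $V(G)$ put $$F(G,P)=\lim_{n\to\infty}\frac1n\log f\bigl(G^{\boxtimes n}[T^n_{P^{(n)}}]\bigr),$$ where $P^{(n)}$ is any sequence of $n$-types on $V(G)$ (distributions with values in $\frac1n\mathbb{Z}$) converging to $P$, and $T^n_{Q}\subseteq V(G)^n$ is the set of strings with empirical distribution $Q$. (1) Let $G$ be a graph, $f$ a spectral point and $P$ a probability distribution on $V(G)$. Then the limit $F(G,P)$ exists and does not depend on the choice of the sequence $P^{(n)}$, and for every nonempty $S\subseteq V(G)$ $$\log f(G[S])\ \ge\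 F(G,P)-(1-P(S))\log|V(G)|-1 .$$ (2) Let $G$ be a graph and $\mu$ a probability measure on $V(G)^\infty$ (with the product of the discrete $\sigma$-algebras), with marginals $\mu_{1\ldots n}$ on $V(G)^n$. Suppose that $(G,\mu)$ has the asymptotic equipartition property, i.e. for every spectral point $f$ the limit $$\lim_{n\to\infty}\ \min_{\substack{S\subseteq V(G)^n\\ \mu_{1\ldots n}(S)\ge c}}\frac1n\log f(G^{\boxtimes n}[S])$$ exists and is the same for all $c\in(0,1)$. Then for every spectral point $f$ this common limit is at least $$\limsup_{n\to\infty}\frac1n F(G^{\boxtimes n},\mu_{1\ldots n}).$$ -/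

import Mathlib

open Filter Topology MeasureTheory

universe u

namespace AmbiguousAEP

/-- The strong product `G ⊠ H`: distinct pairs are adjacent iff in each coordinate they are
adjacent or equal. -/
def strongProd {V W : Type u} (G : SimpleGraph V) (H : SimpleGraph W) :
    SimpleGraph (V × W) where
  Adj x y := x ≠ y ∧ (x.1 = y.1 ∨ G.Adj x.1 y.1) ∧ (x.2 = y.2 ∨ H.Adj x.2 y.2)
  symm := ⟨fun _ _ h => ⟨h.1.symm,
    h.2.1.imp Eq.symm (fun h => G.adj_symm h), h.2.2.imp Eq.symm (fun h => H.adj_symm h)⟩⟩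
  loopless := ⟨fun _ h => h.1 rfl⟩

/-- The `n`-fold strong power `G^{⊠n}` on strings of length `n`: distinct strings are adjacent iff
in every coordinate they are adjacent or equal. -/
def strongPow {V : Type u} (G : SimpleGraph V) (n : ℕ) : SimpleGraph (Fin n → V) where
  Adj x y := x ≠ y ∧ ∀ i, x i = y i ∨ G.Adj (x i) (y i)
  symm := ⟨fun _ _ h => ⟨h.1.symm, fun i => (h.2 i).imp Eq.symm (fun h => G.adj_symm h)⟩⟩
  loopless := ⟨fun _ h => h.1 rfl⟩

/-- An element of the asymptotic spectrum of (finite simple) graphs. The order `H ≤ G` on graphs is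
the existence of a homomorphism `Hᶜ → Gᶜ`; the edgeless graph `⊥` on `d` vertices is the complement
of the complete graph on `d` vertices. -/
structure SpectralPoint where
  toFun : (V : Type u) → [Finite V] → SimpleGraph V → ℝ
  nonneg : ∀ (V : Type u) [Finite V] (G : SimpleGraph V), 0 ≤ toFun V G
  map_sum : ∀ (V W : Type u) [Finite V] [Finite W] (G : SimpleGraph V) (H : SimpleGraph W),
    toFun (V ⊕ W) (G.sum H) = toFun V G + toFun W H
  map_strongProd : ∀ (V W : Type u) [Finite V] [Finite W] (G : SimpleGraph V) (H : SimpleGraph W),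
    toFun (V × W) (strongProd G H) = toFun V G * toFun W H
  mono : ∀ (V W : Type u) [Finite V] [Finite W] (G : SimpleGraph V) (H : SimpleGraph W),
    Nonempty (Hᶜ →g Gᶜ) → toFun W H ≤ toFun V G
  map_edgeless : ∀ (V : Type u) [Finite V], toFun V (⊥ : SimpleGraph V) = Nat.card V

/-- `log₂ f(G[S])`, for the subgraph `G[S]` of `G` induced by `S`. -/
noncomputable def logInduced {V : Type u} [Finite V] (f : SpectralPoint.{u}) (G : SimpleGraph V)
    (S : Set V) : ℝ :=
  Real.logb 2 (f.toFun S (G.induce S))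

/-- The type class of strings of length `n` in which each letter `v` occurs exactly `t v` times. -/
def typeClass {V : Type u} (n : ℕ) (t : V → ℕ) : Set (Fin n → V) :=
  {x | ∀ v, Nat.card {i // x i = v} = t v}

/-- `L` is the value at `(G, P)` of the logarithmic probabilistic refinement of `f`: for every
sequence of `n`-types `P⁽ⁿ⁾ = t n / n` converging to `P`, the numbers
`(1 / n) log₂ f(G^{⊠n}[T])`, with `T` the type class of `P⁽ⁿ⁾`, converge to `L`. -/
def IsLogRefinement {V : Type u} [Fintype V] (f : SpectralPoint.{u}) (G : SimpleGraph V)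
    (P : V → ℝ) (L : ℝ) : Prop :=
  ∀ t : ℕ → V → ℕ, (∀ n, ∑ v, t n v = n) →
    (∀ v, Tendsto (fun n : ℕ => (t n v : ℝ) / n) atTop (𝓝 (P v))) →
    Tendsto (fun n : ℕ => logInduced f (strongPow G n) (typeClass n (t n)) / n) atTop (𝓝 L)

open Classical in
/-- The logarithmic probabilistic refinement `F(G, P)` of `f`. -/
noncomputable def logRefinement {V : Type u} [Fintype V] (f : SpectralPoint.{u})
    (G : SimpleGraph V) (P : V → ℝ) : ℝ :=
  if h : ∃ L, IsLogRefinement f G P L then h.choose else 0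

/-- The joint distribution `μ_{12…n}` of the first `n` letters. -/
noncomputable def marginal {V : Type u} [MeasurableSpace V] (μ : Measure (ℕ → V)) (n : ℕ) :
    Measure (Fin n → V) :=
  μ.map (fun ω i => ω i)

/-- The minimum of `(1 / n) log₂ f(G^{⊠n}[S])` over the sets `S ⊆ V(G)ⁿ` with
`μ_{12…n}(S) ≥ c`. -/
noncomputable def minRate {V : Type u} [Finite V] [MeasurableSpace V] (f : SpectralPoint.{u})
    (G : SimpleGraph V) (μ : Measure (ℕ → V)) (c : ℝ) (n : ℕ) : ℝ :=
  sInf ((fun S : Set (Fin n → V) => logInduced f (strongPow G n) S / n) ''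
    {S | c ≤ (marginal μ n).real S})

/-- `L` is the common limit, for all `c ∈ (0, 1)`, of the minimal rates. -/
def IsCommonLimit {V : Type u} [Finite V] [MeasurableSpace V] (f : SpectralPoint.{u})
    (G : SimpleGraph V) (μ : Measure (ℕ → V)) (L : ℝ) : Prop :=
  ∀ c ∈ Set.Ioo (0 : ℝ) 1, Tendsto (minRate f G μ c) atTop (𝓝 L)

/-- The asymptotic equipartition property of the pair `(G, μ)`. -/
def HasAEP {V : Type u} [Finite V] [MeasurableSpace V] (G : SimpleGraph V)
    (μ : Measure (ℕ → V)) : Prop :=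
  ∀ f : SpectralPoint.{u}, ∃ L : ℝ, IsCommonLimit f G μ L

end AmbiguousAEP

/-!
A spectral point is multiplicative, and it grows by at most a factor `|K|` along a map that becomes
a cohomomorphism once a key in the finite set `K` is known. In particular, deleting `j` of the `n`
letters of the strings in a set lowers `log₂ f` by at most `log₂ C(n, j) + j log₂ |V|`. Conversely,
concatenation makes `t ↦ log₂ f(G^{⊠n}[T])`, with `T` the type class of the letter counts `t`,
superadditive. Comparing `⌊n / m⌋` copies of a type of length `m` with a type of length `n` close to
it, the limit superior of the rates along one sequence of types is thus at most the limit inferior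
along any other with the same limit, so all these sequences share one limit `F(G, P)`.

For the lower bound on `f(G[S])`, delete the letters outside `S`: the remaining strings lie in a
power of `S`, and `C(n, j) ≤ 2ⁿ` accounts for the summand `-1`. Applied to `G^{⊠n}` and to the sets
of mass at least `c`, and divided by `n`, this bound gives the claim about `μ` as `n → ∞` and then
`c → 1`.
-/

namespace AmbiguousAEP

/-- Equality or adjacency of vertices. The strong product and the induced subgraphs are the
coordinatewise and the restricted such relation, and the map underlying a homomorphism `Hᶜ → Gᶜ` is
one along which the relation of `G` pulls back into that of `H`. -/
def AdjOrEq {V : Type u} (G : SimpleGraph V) (x y : V) : Prop := x = y ∨ G.Adj x y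

section AdjOrEq

variable {V W : Type u} {G : SimpleGraph V} {H : SimpleGraph W}

theorem adjOrEq_strongProd {x y : V × W} :
    AdjOrEq (strongProd G H) x y ↔ AdjOrEq G x.1 y.1 ∧ AdjOrEq H x.2 y.2 := by
  by_cases h : x = y <;> simp [AdjOrEq, strongProd, h]

theorem adjOrEq_strongPow {n : ℕ} {x y : Fin n → V} :
    AdjOrEq (strongPow G n) x y ↔ ∀ i, AdjOrEq G (x i) (y i) := by
  by_cases h : x = y <;> simp [AdjOrEq, strongPow, h]

theorem adjOrEq_induce {S : Set V} {x y : S} :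
    AdjOrEq (G.induce S) x y ↔ AdjOrEq G (x : V) y := by
  simp [AdjOrEq, Subtype.ext_iff]

theorem adjOrEq_bot {x y : V} : AdjOrEq (⊥ : SimpleGraph V) x y ↔ x = y := by
  simp [AdjOrEq]

end AdjOrEq

namespace SpectralPoint

variable (f : SpectralPoint.{u}) {V W : Type u} [Finite V] [Finite W]

theorem toFun_le_of_map {G : SimpleGraph V} {H : SimpleGraph W} (φ : W → V)
    (hφ : ∀ x y, AdjOrEq G (φ x) (φ y) → AdjOrEq H x y) : f.toFun W H ≤ f.toFun V G := by
  refine f.mono V W G H ⟨⟨φ, fun {x y} hxy => ?_⟩⟩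
  simpa only [SimpleGraph.compl_adj, AdjOrEq, not_or, ne_eq] using
    mt (hφ x y) (by simpa only [SimpleGraph.compl_adj, AdjOrEq, not_or, ne_eq] using hxy)

theorem toFun_congr {G : SimpleGraph V} {H : SimpleGraph W} (e : V ≃ W)
    (he : ∀ x y, AdjOrEq H (e x) (e y) ↔ AdjOrEq G x y) : f.toFun V G = f.toFun W H :=
  le_antisymm (f.toFun_le_of_map e fun x y => (he x y).1)
    (f.toFun_le_of_map e.symm fun x y h => by simpa using (he _ _).2 h)

theorem toFun_le_card (G : SimpleGraph V) : f.toFun V G ≤ Nat.card V := by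
  rw [← f.map_edgeless]
  exact f.toFun_le_of_map id fun x y h => Or.inl (adjOrEq_bot.1 h)

theorem one_le_toFun [Nonempty V] (G : SimpleGraph V) : 1 ≤ f.toFun V G := by
  have hone : f.toFun PUnit.{u + 1} ⊥ = 1 := by rw [f.map_edgeless, Nat.card_unique, Nat.cast_one]
  rw [← hone]
  exact f.toFun_le_of_map (fun _ => Classical.arbitrary V) fun x y _ => Or.inl rfl

theorem one_le_toFun_induce (G : SimpleGraph V) {S : Set V} (hS : S.Nonempty) :
    1 ≤ f.toFun S (G.induce S) :=
  have := hS.to_subtype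
  f.one_le_toFun _

theorem logInduced_nonneg (G : SimpleGraph V) {S : Set V} (hS : S.Nonempty) :
    0 ≤ logInduced f G S :=
  Real.logb_nonneg one_lt_two (f.one_le_toFun_induce G hS)

theorem toFun_le_card_mul {K : Type u} [Finite K] {G : SimpleGraph V} {H : SimpleGraph W}
    (key : W → K) (φ : W → V)
    (hφ : ∀ x y, key x = key y → AdjOrEq G (φ x) (φ y) → AdjOrEq H x y) :
    f.toFun W H ≤ Nat.card K * f.toFun V G := by
  rw [← f.map_edgeless, ← f.map_strongProd]
  refine f.toFun_le_of_map (fun x => (key x, φ x)) fun x y h => ?_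
  rw [adjOrEq_strongProd, adjOrEq_bot] at h
  exact hφ x y h.1 h.2

theorem map_strongPow (G : SimpleGraph V) (n : ℕ) :
    f.toFun (Fin n → V) (strongPow G n) = f.toFun V G ^ n := by
  induction n with
  | zero =>
    rw [pow_zero]
    exact le_antisymm ((f.toFun_le_card _).trans_eq (by simp)) (f.one_le_toFun _)
  | succ n ih =>
    rw [pow_succ', ← ih, ← f.map_strongProd]
    refine (f.toFun_congr (Fin.consEquiv fun _ => V) fun x y => ?_).symm
    simp [adjOrEq_strongPow, adjOrEq_strongProd, Fin.forall_fin_succ]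

theorem toFun_induce_le_pow (G : SimpleGraph V) {n : ℕ} {S : Set V} {T : Set (Fin n → V)}
    (hT : ∀ x ∈ T, ∀ i, x i ∈ S) :
    f.toFun T ((strongPow G n).induce T) ≤ f.toFun S (G.induce S) ^ n := by
  rw [← f.map_strongPow]
  refine f.toFun_le_of_map (fun x i => ⟨x.1 i, hT x.1 x.2 i⟩) fun x y h => ?_
  simpa only [adjOrEq_strongPow, adjOrEq_induce] using h

theorem toFun_induce_mul_le (G : SimpleGraph V) {m n : ℕ} {S : Set (Fin m → V)}
    {T : Set (Fin n → V)} {U : Set (Fin (m + n) → V)}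
    (hU : ∀ x ∈ S, ∀ y ∈ T, Fin.append x y ∈ U) :
    f.toFun S ((strongPow G m).induce S) * f.toFun T ((strongPow G n).induce T) ≤
      f.toFun U ((strongPow G (m + n)).induce U) := by
  rw [← f.map_strongProd]
  refine f.toFun_le_of_map (fun z => ⟨Fin.append z.1.1 z.2.1, hU _ z.1.2 _ z.2.2⟩) fun x y h => ?_
  simp only [adjOrEq_strongProd, adjOrEq_induce, adjOrEq_strongPow] at h ⊢
  exact ⟨fun i => by simpa using h (Fin.castAdd n i), fun i => by simpa using h (Fin.natAdd m i)⟩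

end SpectralPoint

section Subsequences

variable {V : Type u} {m n : ℕ}

theorem card_orderEmb_fin : Nat.card (Fin m ↪o Fin n) = n.choose m := by
  rw [Nat.card_congr Set.powersetCard.ofFinEmbEquiv, Set.powersetCard.card, Nat.card_fin]

/-- The positions of a subsequence of length `m` of a string of length `n`, together with the
letters at the remaining positions. -/
abbrev SubsequenceComplement (V : Type u) (m n : ℕ) : Type u :=
  Σ σ : Fin m ↪o Fin n, ((Set.range σ)ᶜ : Set (Fin n)) → V

theorem card_subsequenceComplement [Finite V] :
    Nat.card (SubsequenceComplement V m n) = n.choose m * Nat.card V ^ (n - m) := by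
  have hcompl (σ : Fin m ↪o Fin n) : Nat.card ((Set.range σ)ᶜ : Set (Fin n)) = n - m := by
    rw [Nat.card_coe_set_eq, Set.ncard_compl, Set.ncard_range_of_injective σ.injective]
    simp
  simp only [Nat.card_sigma, Nat.card_fun, hcompl, Finset.sum_const, Finset.card_univ, smul_eq_mul]
  rw [← Nat.card_eq_fintype_card, card_orderEmb_fin]

/-- A string of `B` is recovered from a subsequence in `A`, the positions of the latter and the
remaining letters. -/
theorem SpectralPoint.toFun_induce_le_choose_mul (f : SpectralPoint.{u}) [Finite V]
    (G : SimpleGraph V) {A : Set (Fin m → V)} {B : Set (Fin n → V)}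
    (hB : ∀ x ∈ B, ∃ σ : Fin m ↪o Fin n, x ∘ σ ∈ A) :
    f.toFun B ((strongPow G n).induce B) ≤
      n.choose m * (Nat.card V : ℝ) ^ (n - m) * f.toFun A ((strongPow G m).induce A) := by
  choose σ hσ using fun x : B => hB x x.2
  have hcard : (n.choose m : ℝ) * (Nat.card V : ℝ) ^ (n - m) =
      Nat.card (SubsequenceComplement V m n) := by
    rw [card_subsequenceComplement]; push_cast; rfl
  rw [hcard]
  refine f.toFun_le_card_mul (fun x => (⟨σ x, fun i => x.1 i⟩ : SubsequenceComplement V m n))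
    (fun x => ⟨x.1 ∘ σ x, hσ x⟩) fun x y hkey hA => ?_
  obtain ⟨hpos, hrest⟩ := Sigma.mk.inj_iff.1 hkey
  rw [adjOrEq_induce, adjOrEq_strongPow] at hA ⊢
  replace hA : ∀ k, AdjOrEq G (x.1 (σ x k)) (y.1 (σ y k)) := hA
  rw [← hpos] at hrest hA
  intro i
  by_cases hi : i ∈ Set.range (σ x)
  · obtain ⟨k, rfl⟩ := hi
    exact hA k
  · exact Or.inl (congrFun (eq_of_heq hrest) ⟨i, hi⟩)

end Subsequences

section TypeClass

open scoped Finset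

variable {V : Type u} {m n : ℕ} {s t : V → ℕ}

theorem mem_typeClass [DecidableEq V] {x : Fin n → V} :
    x ∈ typeClass n t ↔ ∀ v, #{i | x i = v} = t v := by
  simp [typeClass, Fintype.card_subtype]

theorem typeClass_nonempty [Fintype V] (ht : ∑ v, t v = n) : (typeClass n t).Nonempty := by
  classical
  let e : (Σ v, Fin (t v)) ≃ Fin n := Fintype.equivOfCardEq (by simp [ht])
  refine ⟨fun i => (e.symm i).1, fun v => ?_⟩
  rw [← Nat.card_fin (t v)]
  exact Nat.card_congr <|
    (e.symm.subtypeEquiv (q := fun p => p.1 = v) fun _ => Iff.rfl).trans (Equiv.sigmaSubtype v)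

theorem apply_mem_support_of_mem_typeClass {x : Fin n → V} (hx : x ∈ typeClass n t) (i : Fin n) :
    x i ∈ t.support := by
  rw [Function.mem_support, ← hx (x i)]
  exact (Nat.card_pos_iff.2 ⟨⟨i, rfl⟩, inferInstance⟩).ne'

theorem append_mem_typeClass {x : Fin m → V} {y : Fin n → V} (hx : x ∈ typeClass m s)
    (hy : y ∈ typeClass n t) : Fin.append x y ∈ typeClass (m + n) (s + t) := by
  classical
  rw [mem_typeClass] at *
  intro v
  have hsplit := Fin.sum_univ_add fun i => if Fin.append x y i = v then 1 else 0
  simpa [hx v, hy v] using hsplit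

theorem exists_comp_mem_typeClass [Fintype V] (hs : ∑ v, s v = m) (hst : s ≤ t) {x : Fin n → V}
    (hx : x ∈ typeClass n t) : ∃ σ : Fin m ↪o Fin n, x ∘ σ ∈ typeClass m s := by
  classical
  rw [mem_typeClass] at hx
  choose K hK hKcard using fun v =>
    Finset.exists_subset_card_eq (s := {i | x i = v}) ((hst v).trans_eq (hx v).symm)
  let J : Finset (Fin n) := {i | i ∈ K (x i)}
  have hfiber (v : V) : J.filter (fun i => x i = v) = K v := by
    ext i
    have hxi : i ∈ K v → x i = v := fun hi => by simpa using hK v hi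
    simp only [J, Finset.mem_filter, Finset.mem_univ, true_and]
    exact ⟨fun ⟨hi, hv⟩ => hv ▸ hi, fun hi => ⟨(hxi hi).symm ▸ hi, hxi hi⟩⟩
  have hJ : #J = m := by
    rw [Finset.card_eq_sum_card_fiberwise (f := x) (t := Finset.univ) (by simp), ← hs]
    simp only [hfiber, hKcard]
  refine ⟨J.orderEmbOfFin hJ, mem_typeClass.2 fun v => ?_⟩
  have hmap := Finset.filter_map (f := (J.orderEmbOfFin hJ).toEmbedding) (s := Finset.univ)
    (p := fun i => x i = v)
  rw [Finset.map_orderEmbOfFin_univ, hfiber] at hmap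
  rw [← hKcard v, hmap, Finset.card_map]
  rfl

end TypeClass

section LogTypeClass

theorem logb_choose_le {n j : ℕ} (hj : j ≤ n) {x : ℝ} (hx : 0 < x) :
    Real.logb 2 (n.choose j) ≤ n * Real.logb 2 (1 + x) - j * Real.logb 2 x := by
  have hterm : x ^ j * n.choose j ≤ (1 + x) ^ n := by
    rw [add_comm, add_pow]
    simpa using Finset.single_le_sum (f := fun i => x ^ i * 1 ^ (n - i) * (n.choose i : ℝ))
      (fun i _ => by positivity) (Finset.mem_range_succ_iff.2 hj)
  have hchoose := Nat.choose_pos hj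
  rw [← Real.logb_pow, ← Real.logb_pow, ← Real.logb_div (by positivity) (by positivity)]
  refine Real.logb_le_logb_of_le one_lt_two (by positivity) ?_
  rwa [le_div_iff₀' (by positivity)]

/-- `log₂ f(G^{⊠n}[T])` for the type class `T` of the strings with letter counts `t`, whose length
`n` is the sum of the counts. -/
noncomputable def logTypeClass {V : Type u} [Fintype V] (f : SpectralPoint.{u}) (G : SimpleGraph V)
    (t : V → ℕ) : ℝ :=
  logInduced f (strongPow G (∑ v, t v)) (typeClass (∑ v, t v) t)

variable (f : SpectralPoint.{u}) {V : Type u} [Fintype V] (G : SimpleGraph V)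

theorem logInduced_typeClass {n : ℕ} {t : V → ℕ} (ht : ∑ v, t v = n) :
    logInduced f (strongPow G n) (typeClass n t) = logTypeClass f G t := by
  subst ht; rfl

theorem logTypeClass_nonneg (t : V → ℕ) : 0 ≤ logTypeClass f G t :=
  f.logInduced_nonneg _ (typeClass_nonempty rfl)

theorem logTypeClass_le_of_support_subset {S : Set V} {t : V → ℕ} (ht : t.support ⊆ S) :
    logTypeClass f G t ≤ (∑ v, t v : ℕ) * logInduced f G S := by
  have hone := f.one_le_toFun_induce (strongPow G _) (typeClass_nonempty (t := t) rfl)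
  rw [logInduced, ← Real.logb_pow]
  exact Real.logb_le_logb_of_le one_lt_two (by positivity)
    (f.toFun_induce_le_pow G fun x hx i => ht (apply_mem_support_of_mem_typeClass hx i))

theorem logTypeClass_add_le (s t : V → ℕ) :
    logTypeClass f G s + logTypeClass f G t ≤ logTypeClass f G (s + t) := by
  have hs := f.one_le_toFun_induce (strongPow G _) (typeClass_nonempty (t := s) rfl)
  have ht := f.one_le_toFun_induce (strongPow G _) (typeClass_nonempty (t := t) rfl)
  rw [← logInduced_typeClass f G (t := s + t) Finset.sum_add_distrib]
  unfold logTypeClass logInduced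
  rw [← Real.logb_mul (by positivity) (by positivity)]
  exact Real.logb_le_logb_of_le one_lt_two (by positivity)
    (f.toFun_induce_mul_le G fun x hx y hy => append_mem_typeClass hx hy)

theorem logTypeClass_mono : Monotone (logTypeClass f G) := fun s t hst => by
  have hadd := logTypeClass_add_le f G s (t - s)
  rw [add_tsub_cancel_of_le hst] at hadd
  linarith [logTypeClass_nonneg f G (t - s)]

theorem mul_logTypeClass_le_nsmul (k : ℕ) (t : V → ℕ) :
    k * logTypeClass f G t ≤ logTypeClass f G (k • t) := by
  induction k with
  | zero => simpa using logTypeClass_nonneg f G 0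
  | succ k ih =>
    have hadd := logTypeClass_add_le f G (k • t) t
    rw [← succ_nsmul] at hadd
    push_cast
    linarith

variable [Nonempty V]

theorem logTypeClass_le_of_le {s t : V → ℕ} (hst : s ≤ t) :
    logTypeClass f G t ≤ logTypeClass f G s + Real.logb 2 ((∑ v, t v).choose (∑ v, s v)) +
      (∑ v, t v - ∑ v, s v : ℕ) * Real.logb 2 (Fintype.card V) := by
  have hchoose : 0 < (∑ v, t v).choose (∑ v, s v) :=
    Nat.choose_pos (Finset.sum_le_sum fun v _ => hst v)
  have ht := f.one_le_toFun_induce (strongPow G _) (typeClass_nonempty (t := t) rfl)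
  have hs := f.one_le_toFun_induce (strongPow G _) (typeClass_nonempty (t := s) rfl)
  have hle := Real.logb_le_logb_of_le one_lt_two (by positivity)
    (f.toFun_induce_le_choose_mul G fun x hx => exists_comp_mem_typeClass rfl hst hx)
  rw [Nat.card_eq_fintype_card, Real.logb_mul (by positivity) (by positivity),
    Real.logb_mul (by positivity) (by positivity), Real.logb_pow] at hle
  unfold logTypeClass logInduced
  linarith

theorem logTypeClass_le_add_logInduced (t : V → ℕ) (S : Finset V) :
    logTypeClass f G t ≤ (∑ v, t v : ℕ) + (∑ v ∈ S, t v : ℕ) * logInduced f G S +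
      (∑ v, t v - ∑ v ∈ S, t v : ℕ) * Real.logb 2 (Fintype.card V) := by
  let tS : V → ℕ := (S : Set V).indicator t
  have hsum : ∑ v, tS v = ∑ v ∈ S, t v := Finset.sum_indicator_subset t S.subset_univ
  have hle : tS ≤ t := Set.indicator_le_self _ _
  have hdelete := logTypeClass_le_of_le f G hle
  have hsupport := logTypeClass_le_of_support_subset f G (t := tS) Set.support_indicator_subset
  have hchoose : Real.logb 2 ((∑ v, t v).choose (∑ v, tS v)) ≤ (∑ v, t v : ℕ) := by
    have hpos := Nat.choose_pos (Finset.sum_le_sum fun v (_ : v ∈ Finset.univ) => hle v)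
    rw [Real.logb_le_iff_le_rpow one_lt_two (by positivity), Real.rpow_natCast]
    exact_mod_cast Nat.choose_le_two_pow _ _
  rw [hsum] at hdelete hsupport hchoose
  linarith

theorem logTypeClass_le_add_tsub (s t : V → ℕ) {x : ℝ} (hx : 0 < x) :
    logTypeClass f G s ≤ logTypeClass f G t + (∑ v, s v : ℕ) * Real.logb 2 (1 + x) +
      (∑ v, (s v - t v) : ℕ) * (Real.logb 2 (Fintype.card V) - Real.logb 2 x) := by
  have hinf : ∑ v, (s ⊓ t) v + ∑ v, (s v - t v) = ∑ v, s v := by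
    rw [← Finset.sum_add_distrib]
    exact Finset.sum_congr rfl fun v _ => by simp only [Pi.inf_apply]; omega
  have hsub : ∑ v, s v - ∑ v, (s ⊓ t) v = ∑ v, (s v - t v) := by omega
  have hdelete := logTypeClass_le_of_le f G (inf_le_left : s ⊓ t ≤ s)
  have hmono := logTypeClass_mono f G (inf_le_right : s ⊓ t ≤ t)
  have hchoose := logb_choose_le (n := ∑ v, s v) (j := ∑ v, (s v - t v)) (by omega) hx
  rw [Nat.choose_symm_of_eq_add (by omega : ∑ v, s v = ∑ v, (s v - t v) + ∑ v, (s ⊓ t) v)]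
    at hchoose
  rw [hsub] at hdelete
  linarith

end LogTypeClass

section TypeSequence

variable {V : Type u} [Fintype V]

/-- The distributions `t n / n` form a sequence of `n`-types converging to `P`. -/
structure IsTypeSequence (t : ℕ → V → ℕ) (P : V → ℝ) : Prop where
  sum_eq : ∀ n, ∑ v, t n v = n
  tendsto : ∀ v, Tendsto (fun n : ℕ => (t n v : ℝ) / n) atTop (𝓝 (P v))

theorem nonempty_of_mem_stdSimplex {P : V → ℝ} (hP : P ∈ stdSimplex ℝ V) : Nonempty V := by
  by_contra hV
  rw [not_nonempty_iff] at hV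
  simpa using hP.2

theorem exists_isTypeSequence {P : V → ℝ} (hP : P ∈ stdSimplex ℝ V) :
    ∃ t, IsTypeSequence t P := by
  classical
  obtain ⟨v₀⟩ := nonempty_of_mem_stdSimplex hP
  let floors (n : ℕ) (v : V) : ℕ := ⌊P v * n⌋₊
  let deficit (n : ℕ) : ℕ := n - ∑ v, floors n v
  have hfloors (v : V) : Tendsto (fun n : ℕ => (floors n v : ℝ) / n) atTop (𝓝 (P v)) :=
    (tendsto_nat_floor_mul_div_atTop (hP.1 v)).comp tendsto_natCast_atTop_atTop
  have hle (n : ℕ) : ∑ v, floors n v ≤ n := by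
    have hreal : ∑ v, (floors n v : ℝ) ≤ n := calc
      ∑ v, (floors n v : ℝ) ≤ ∑ v, P v * n :=
        Finset.sum_le_sum fun v _ => Nat.floor_le (mul_nonneg (hP.1 v) n.cast_nonneg)
      _ = n := by rw [← Finset.sum_mul, hP.2, one_mul]
    exact_mod_cast hreal
  have hdeficit : Tendsto (fun n : ℕ => (deficit n : ℝ) / n) atTop (𝓝 0) := by
    have hlim : Tendsto (fun n : ℕ => 1 - ∑ v, (floors n v : ℝ) / n) atTop (𝓝 (1 - ∑ v, P v)) :=
      (tendsto_finsetSum _ fun v _ => hfloors v).const_sub 1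
    rw [hP.2, sub_self] at hlim
    refine hlim.congr' ?_
    filter_upwards [eventually_ne_atTop 0] with n hn
    rw [Nat.cast_sub (hle n), sub_div, div_self (by exact_mod_cast hn), ← Finset.sum_div,
      Nat.cast_sum]
  refine ⟨fun n => floors n + Pi.single v₀ (deficit n), fun n => ?_, fun v => ?_⟩
  · simp [Finset.sum_add_distrib, deficit, hle n]
  · rcases eq_or_ne v v₀ with rfl | hv
    · simpa [add_div] using (hfloors v).add hdeficit
    · simpa [hv] using hfloors v

theorem tendsto_natCast_tsub_div {a b : ℕ → ℕ} {A B : ℝ}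
    (ha : Tendsto (fun n : ℕ => (a n : ℝ) / n) atTop (𝓝 A))
    (hb : Tendsto (fun n : ℕ => (b n : ℝ) / n) atTop (𝓝 B)) :
    Tendsto (fun n : ℕ => ((a n - b n : ℕ) : ℝ) / n) atTop (𝓝 (max (A - B) 0)) := by
  refine ((ha.sub hb).max tendsto_const_nhds).congr fun n => ?_
  rw [← sub_div, ← zero_div (n : ℝ), max_div_div_right n.cast_nonneg]
  congr 1
  rcases le_total (a n) (b n) with h | h
  · rw [Nat.sub_eq_zero_of_le h, Nat.cast_zero, max_eq_right]
    exact sub_nonpos.2 (Nat.cast_le.2 h)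
  · rw [Nat.cast_sub h, max_eq_left]
    exact sub_nonneg.2 (Nat.cast_le.2 h)

theorem tendsto_natDiv_div (m : ℕ) :
    Tendsto (fun n : ℕ => ((n / m : ℕ) : ℝ) / n) atTop (𝓝 (1 / m : ℝ)) := by
  refine ((tendsto_nat_floor_mul_div_atTop (R := ℝ) (a := 1 / (m : ℝ)) (by positivity)).comp
    tendsto_natCast_atTop_atTop).congr fun n => ?_
  rw [Function.comp_apply, one_div_mul_eq_div, Nat.floor_div_eq_div]

end TypeSequence

section Convergence

variable (f : SpectralPoint.{u}) {V : Type u} [Fintype V] (G : SimpleGraph V)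

theorem isBoundedUnder_ge_logTypeClass_div (t : ℕ → V → ℕ) :
    IsBoundedUnder (· ≥ ·) atTop fun n : ℕ => logTypeClass f G (t n) / n :=
  isBoundedUnder_of ⟨0, fun n => div_nonneg (logTypeClass_nonneg f G (t n)) n.cast_nonneg⟩

variable {f G} {P : V → ℝ}

theorem IsTypeSequence.isBoundedUnder_le_logTypeClass_div {t : ℕ → V → ℕ}
    (ht : IsTypeSequence t P) :
    IsBoundedUnder (· ≤ ·) atTop fun n : ℕ => logTypeClass f G (t n) / n := by
  refine ⟨logInduced f G Set.univ, eventually_map.2 ?_⟩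
  filter_upwards [eventually_gt_atTop 0] with n hn
  have hle := logTypeClass_le_of_support_subset f G (Set.subset_univ (t n).support)
  rw [ht.sum_eq] at hle
  exact (div_le_iff₀' (by exact_mod_cast hn)).2 hle

/-- `⌊n / m⌋` copies of a string of type `s` have almost the letter counts `t n`, up to the excess
of `s / m` over `P`. -/
theorem IsTypeSequence.logTypeClass_div_le_liminf_add [Nonempty V] {t : ℕ → V → ℕ}
    (ht : IsTypeSequence t P) {m : ℕ} (hm : m ≠ 0) {s : V → ℕ} (hs : ∑ v, s v = m) {x : ℝ}
    (hx : 0 < x) :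
    logTypeClass f G s / m ≤
      liminf (fun n : ℕ => logTypeClass f G (t n) / n) atTop + Real.logb 2 (1 + x) +
        (∑ v, max ((s v : ℝ) / m - P v) 0) * (Real.logb 2 (Fintype.card V) - Real.logb 2 x) := by
  set C := Real.logb 2 (Fintype.card V) - Real.logb 2 x
  let excess (n : ℕ) : ℕ := ∑ v, (n / m * s v - t n v)
  have hcopies (n : ℕ) : (n / m : ℕ) * logTypeClass f G s ≤
      logTypeClass f G (t n) + (n / m : ℕ) * m * Real.logb 2 (1 + x) + excess n * C := by
    have hle := (mul_logTypeClass_le_nsmul f G (n / m) s).trans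
      (logTypeClass_le_add_tsub f G ((n / m) • s) (t n) hx)
    simpa only [Pi.smul_apply, smul_eq_mul, ← Finset.mul_sum, hs, Nat.cast_mul] using hle
  have hexcess : Tendsto (fun n : ℕ => (excess n : ℝ) / n) atTop
      (𝓝 (∑ v, max ((s v : ℝ) / m - P v) 0)) := by
    simp only [excess, Nat.cast_sum, Finset.sum_div]
    refine tendsto_finsetSum _ fun v _ => tendsto_natCast_tsub_div ?_ (ht.tendsto v)
    simpa only [Nat.cast_mul, div_mul_eq_mul_div, one_mul] using
      (tendsto_natDiv_div m).mul_const (s v : ℝ)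
  have hrate : Tendsto (fun n : ℕ => ((n / m : ℕ) : ℝ) / n *
      (logTypeClass f G s - m * Real.logb 2 (1 + x)) - (excess n : ℝ) / n * C) atTop
      (𝓝 (1 / m * (logTypeClass f G s - m * Real.logb 2 (1 + x)) -
        (∑ v, max ((s v : ℝ) / m - P v) 0) * C)) :=
    ((tendsto_natDiv_div m).mul_const _).sub (hexcess.mul_const C)
  have hliminf := liminf_le_liminf (Eventually.of_forall fun n => ?_) hrate.isBoundedUnder_ge
    (ht.isBoundedUnder_le_logTypeClass_div (f := f) (G := G)).isCoboundedUnder_ge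
  · rw [hrate.liminf_eq, mul_sub, one_div_mul_eq_div, one_div, inv_mul_cancel_left₀ (by simpa)]
      at hliminf
    linarith
  · rw [div_mul_eq_mul_div, div_mul_eq_mul_div, ← sub_div]
    exact div_le_div_of_nonneg_right (by linarith [hcopies n]) n.cast_nonneg

theorem tendsto_logb_one_add : Tendsto (fun x : ℝ => Real.logb 2 (1 + x)) (𝓝[>] 0) (𝓝 0) := by
  have hcont : ContinuousAt (fun x : ℝ => Real.logb 2 (1 + x)) 0 :=
    ContinuousAt.div_const (ContinuousAt.log (by fun_prop) (by norm_num)) _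
  simpa using hcont.tendsto.mono_left nhdsWithin_le_nhds

theorem IsTypeSequence.limsup_le_liminf [Nonempty V] {s t : ℕ → V → ℕ}
    (hs : IsTypeSequence s P) (ht : IsTypeSequence t P) :
    limsup (fun n : ℕ => logTypeClass f G (s n) / n) atTop ≤
      liminf (fun n : ℕ => logTypeClass f G (t n) / n) atTop := by
  set b := liminf (fun n : ℕ => logTypeClass f G (t n) / n) atTop
  have hbound (x : ℝ) (hx : 0 < x) :
      limsup (fun n : ℕ => logTypeClass f G (s n) / n) atTop ≤ b + Real.logb 2 (1 + x) := by
    set C := Real.logb 2 (Fintype.card V) - Real.logb 2 x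
    have hlim : Tendsto (fun m : ℕ => b + Real.logb 2 (1 + x) +
        (∑ v, max ((s m v : ℝ) / m - P v) 0) * C) atTop
        (𝓝 (b + Real.logb 2 (1 + x) + (∑ v, max (P v - P v) 0) * C)) :=
      ((tendsto_finsetSum _ fun v _ => ((hs.tendsto v).sub_const (P v)).max
        tendsto_const_nhds).mul_const C).const_add _
    simp only [sub_self, max_self, Finset.sum_const_zero, zero_mul, add_zero] at hlim
    rw [← hlim.limsup_eq]
    refine limsup_le_limsup ?_ (isBoundedUnder_ge_logTypeClass_div f G s).isCoboundedUnder_le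
      hlim.isBoundedUnder_le
    filter_upwards [eventually_ne_atTop 0] with m hm
    exact ht.logTypeClass_div_le_liminf_add hm (hs.sum_eq m) hx
  have hlim := tendsto_logb_one_add.const_add b
  rw [add_zero] at hlim
  exact ge_of_tendsto hlim (eventually_mem_nhdsWithin.mono hbound)

theorem exists_isLogRefinement (hP : P ∈ stdSimplex ℝ V) : ∃ L, IsLogRefinement f G P L := by
  have := nonempty_of_mem_stdSimplex hP
  obtain ⟨s, hs⟩ := exists_isTypeSequence hP
  refine ⟨liminf (fun n : ℕ => logTypeClass f G (s n) / n) atTop, fun t htsum htP => ?_⟩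
  have ht : IsTypeSequence t P := ⟨htsum, htP⟩
  simp only [logInduced_typeClass f G (htsum _)]
  have hbelow := isBoundedUnder_ge_logTypeClass_div f G s
  have habove := hs.isBoundedUnder_le_logTypeClass_div (f := f) (G := G)
  exact tendsto_of_le_liminf_of_limsup_le
    ((liminf_le_limsup habove hbelow).trans (hs.limsup_le_liminf ht)) (ht.limsup_le_liminf hs)
    ht.isBoundedUnder_le_logTypeClass_div (isBoundedUnder_ge_logTypeClass_div f G t)

theorem isLogRefinement_logRefinement (hP : P ∈ stdSimplex ℝ V) :
    IsLogRefinement f G P (logRefinement f G P) := by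
  have hex := exists_isLogRefinement (f := f) (G := G) hP
  rw [logRefinement, dif_pos hex]
  exact hex.choose_spec

theorem logRefinement_le_add_logInduced (hP : P ∈ stdSimplex ℝ V) (S : Finset V) :
    logRefinement f G P ≤ 1 + (∑ v ∈ S, P v) * logInduced f G S +
      (1 - ∑ v ∈ S, P v) * Real.logb 2 (Fintype.card V) := by
  have := nonempty_of_mem_stdSimplex hP
  obtain ⟨t, ht⟩ := exists_isTypeSequence hP
  have hsum : Tendsto (fun n : ℕ => ∑ v ∈ S, (t n v : ℝ) / n) atTop (𝓝 (∑ v ∈ S, P v)) :=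
    tendsto_finsetSum _ fun v _ => ht.tendsto v
  refine le_of_tendsto_of_tendsto (isLogRefinement_logRefinement hP t ht.sum_eq ht.tendsto)
    (((hsum.mul_const (logInduced f G S)).const_add 1).add
      ((hsum.const_sub 1).mul_const (Real.logb 2 (Fintype.card V)))) ?_
  filter_upwards [eventually_gt_atTop 0] with n hn
  have hle := logTypeClass_le_add_logInduced f G (t n) S
  have hsub : ∑ v ∈ S, t n v ≤ n :=
    (Finset.sum_le_sum_of_subset S.subset_univ).trans_eq (ht.sum_eq n)
  rw [ht.sum_eq n, Nat.cast_sub hsub, Nat.cast_sum] at hle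
  rw [logInduced_typeClass f G (ht.sum_eq n), ← Finset.sum_div,
    div_le_iff₀ (by exact_mod_cast hn)]
  refine hle.trans_eq ?_
  field_simp

theorem logRefinement_sub_le_logInduced (hP : P ∈ stdSimplex ℝ V) {S : Finset V}
    (hS : S.Nonempty) :
    logRefinement f G P - (1 - ∑ v ∈ S, P v) * Real.logb 2 (Fintype.card V) - 1 ≤
      logInduced f G S := by
  have hmass : ∑ v ∈ S, P v ≤ 1 :=
    (Finset.sum_le_univ_sum_of_nonneg hP.1).trans_eq hP.2
  have hscale : (∑ v ∈ S, P v) * logInduced f G S ≤ logInduced f G S :=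
    mul_le_of_le_one_left (f.logInduced_nonneg G (Finset.coe_nonempty.2 hS)) hmass
  linarith [logRefinement_le_add_logInduced (f := f) (G := G) hP S]

end Convergence

section AEP

variable {f : SpectralPoint.{u}} {V : Type u} [MeasurableSpace V] {G : SimpleGraph V}
  {μ : Measure (ℕ → V)}

theorem IsCommonLimit.iSup_limsup_minRate_le [Finite V] {L : ℝ} (hL : IsCommonLimit f G μ L) :
    ⨆ c ∈ Set.Ioo (0 : ℝ) 1, limsup (fun n : ℕ => (minRate f G μ c n : EReal)) atTop ≤ L :=
  iSup₂_le fun c hc => ((continuous_coe_real_ereal.tendsto L).comp (hL c hc)).limsup_eq.le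

variable (f G μ) [Fintype V] [IsProbabilityMeasure μ]

instance marginal.instIsProbabilityMeasure (n : ℕ) : IsProbabilityMeasure (marginal μ n) :=
  Measure.isProbabilityMeasure_map
    (measurable_pi_lambda _ fun _ => measurable_pi_apply _).aemeasurable

variable [DiscreteMeasurableSpace V]

theorem marginal_mem_stdSimplex (n : ℕ) :
    (fun x => (marginal μ n).real {x}) ∈ stdSimplex ℝ (Fin n → V) :=
  ⟨fun _ => measureReal_nonneg, by rw [sum_measureReal_singleton, Finset.coe_univ, probReal_univ]⟩

theorem logRefinement_marginal_div_le {n : ℕ} (hn : 0 < n) {c : ℝ} (hc : 0 < c)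
    {S : Set (Fin n → V)} (hS : c ≤ (marginal μ n).real S) :
    logRefinement f (strongPow G n) (fun x => (marginal μ n).real {x}) / n ≤
      logInduced f (strongPow G n) S / n + (1 - c) * Real.logb 2 (Fintype.card V) + 1 / n := by
  lift S to Finset (Fin n → V) using S.toFinite
  have hne : S.Nonempty := by
    rw [Finset.nonempty_iff_ne_empty]
    rintro rfl
    rw [Finset.coe_empty, measureReal_empty] at hS
    exact hS.not_gt hc
  have hle := logRefinement_sub_le_logInduced (f := f) (G := strongPow G n)
    (marginal_mem_stdSimplex μ n) hne
  rw [sum_measureReal_singleton, Fintype.card_fun, Fintype.card_fin, Nat.cast_pow,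
    Real.logb_pow] at hle
  have hlog : 0 ≤ Real.logb 2 (Fintype.card V) := by
    obtain ⟨ω⟩ := nonempty_of_isProbabilityMeasure μ
    have : Nonempty V := ⟨ω 0⟩
    exact Real.logb_nonneg one_lt_two (Nat.one_le_cast.2 Fintype.card_pos)
  have hmass : (1 - (marginal μ n).real S) * (n * Real.logb 2 (Fintype.card V)) ≤
      (1 - c) * (n * Real.logb 2 (Fintype.card V)) := by
    gcongr
  rw [div_le_iff₀ (by exact_mod_cast hn)]
  field_simp
  linarith

theorem logRefinement_marginal_div_le_minRate {n : ℕ} (hn : 0 < n) {c : ℝ}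
    (hc : c ∈ Set.Ioo (0 : ℝ) 1) :
    logRefinement f (strongPow G n) (fun x => (marginal μ n).real {x}) / n ≤
      minRate f G μ c n + (1 - c) * Real.logb 2 (Fintype.card V) + 1 / n := by
  have huniv : c ≤ (marginal μ n).real Set.univ := by simpa using hc.2.le
  rw [add_assoc, ← sub_le_iff_le_add]
  refine le_csInf ⟨_, Set.mem_image_of_mem _ huniv⟩ ?_
  rintro _ ⟨S, hS, rfl⟩
  rw [sub_le_iff_le_add, ← add_assoc]
  exact logRefinement_marginal_div_le f G μ hn hc.1 hS

theorem limsup_logRefinement_marginal_le :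
    limsup (fun n : ℕ =>
      ((logRefinement f (strongPow G n) (fun x => (marginal μ n).real {x}) / n : ℝ) : EReal))
        atTop ≤
      ⨆ c ∈ Set.Ioo (0 : ℝ) 1, limsup (fun n : ℕ => (minRate f G μ c n : EReal)) atTop := by
  rw [← EReal.le_of_forall_lt_iff_le]
  intro z hz
  obtain ⟨y, hy, hyz⟩ := EReal.lt_iff_exists_real_btwn.1 hz
  have hgap : ∀ᶠ c : ℝ in 𝓝[<] 1, y + (1 - c) * Real.logb 2 (Fintype.card V) < z := by
    have hcont : Continuous fun c : ℝ => y + (1 - c) * Real.logb 2 (Fintype.card V) := by fun_prop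
    refine (hcont.tendsto 1).mono_left nhdsWithin_le_nhds |>.eventually_lt_const ?_
    simpa using hyz
  obtain ⟨c, hcz, hc⟩ := (hgap.and (Ioo_mem_nhdsLT one_pos)).exists
  have hminRate : ∀ᶠ n : ℕ in atTop, (minRate f G μ c n : EReal) < y :=
    eventually_lt_of_limsup_lt ((le_iSup₂ (f := fun (c : ℝ) (_ : c ∈ Set.Ioo (0 : ℝ) 1) =>
      limsup (fun n : ℕ => (minRate f G μ c n : EReal)) atTop) c hc).trans_lt hy)
  have hlim : Tendsto (fun n : ℕ => y + (1 - c) * Real.logb 2 (Fintype.card V) + 1 / (n : ℝ)) atTop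
      (𝓝 (y + (1 - c) * Real.logb 2 (Fintype.card V) + 0)) :=
    tendsto_one_div_atTop_nhds_zero_nat.const_add _
  rw [add_zero] at hlim
  refine limsup_le_of_le (by isBoundedDefault) ?_
  filter_upwards [hminRate, hlim.eventually_lt_const hcz, eventually_gt_atTop 0] with n hny hnz hn
  have hle := logRefinement_marginal_div_le_minRate f G μ hn hc
  rw [EReal.coe_lt_coe_iff] at hny
  exact EReal.coe_le_coe (by linarith)

end AEP

end AmbiguousAEP

/-- `minRate f G μ c` increases with `c`, so the supremum is the limit as `c → 1`, which under the
asymptotic equipartition property is the common limit. -/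
theorem mainTheorem11_general {V : Type u} [Fintype V] (G : SimpleGraph V) :
    (∀ (f : AmbiguousAEP.SpectralPoint.{u}) (P : V → ℝ), P ∈ stdSimplex ℝ V →
      AmbiguousAEP.IsLogRefinement f G P (AmbiguousAEP.logRefinement f G P) ∧
      ∀ S : Finset V, S.Nonempty →
        AmbiguousAEP.logRefinement f G P
            - (1 - ∑ v ∈ S, P v) * Real.logb 2 (Fintype.card V) - 1
          ≤ AmbiguousAEP.logInduced f G (S : Set V)) ∧
    (∀ [MeasurableSpace V] [DiscreteMeasurableSpace V] (μ : Measure (ℕ → V))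
      [IsProbabilityMeasure μ] (f : AmbiguousAEP.SpectralPoint.{u}),
        limsup (fun n : ℕ =>
          ((AmbiguousAEP.logRefinement f (AmbiguousAEP.strongPow G n)
            (fun x => (AmbiguousAEP.marginal μ n).real {x}) / n : ℝ) : EReal)) atTop
          ≤ ⨆ c ∈ Set.Ioo (0 : ℝ) 1,
            limsup (fun n : ℕ => (AmbiguousAEP.minRate f G μ c n : EReal)) atTop) :=
  ⟨fun _ _ hP => ⟨AmbiguousAEP.isLogRefinement_logRefinement hP,
      fun _ hS => AmbiguousAEP.logRefinement_sub_le_logInduced hP hS⟩,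
    fun μ _ f => AmbiguousAEP.limsup_logRefinement_marginal_le f G μ⟩

theorem mainTheorem11 {V : Type u} [Fintype V] (G : SimpleGraph V) :
    (∀ (f : AmbiguousAEP.SpectralPoint.{u}) (P : V → ℝ), P ∈ stdSimplex ℝ V →
      AmbiguousAEP.IsLogRefinement f G P (AmbiguousAEP.logRefinement f G P) ∧
      ∀ S : Finset V, S.Nonempty →
        AmbiguousAEP.logRefinement f G P
            - (1 - ∑ v ∈ S, P v) * Real.logb 2 (Fintype.card V) - 1
          ≤ AmbiguousAEP.logInduced f G (S : Set V)) ∧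
    (∀ [MeasurableSpace V] [DiscreteMeasurableSpace V] (μ : Measure (ℕ → V))
      [IsProbabilityMeasure μ], AmbiguousAEP.HasAEP G μ →
      ∀ f : AmbiguousAEP.SpectralPoint.{u}, ∃ L : ℝ, AmbiguousAEP.IsCommonLimit f G μ L ∧
        limsup (fun n : ℕ =>
          ((AmbiguousAEP.logRefinement f (AmbiguousAEP.strongPow G n)
            (fun x => (AmbiguousAEP.marginal μ n).real {x}) / n : ℝ) : EReal)) atTop
          ≤ (L : EReal)) := by
  obtain ⟨hrefinement, hlimsup⟩ := mainTheorem11_general G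
  exact ⟨hrefinement, fun μ _ hμ f => (hμ f).imp fun _ hL =>
    ⟨hL, (hlimsup μ f).trans hL.iSup_limsup_minRate_le⟩⟩
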